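/- A Euclidean Jordan algebra is a finite-dimensional real inner product space $(\mathcal V,\langle\cdot,\cdot\rangle)$ with a bilinear product $(x,y)\mapsto x\circ y$ such that, for all $x,y,z\in\mathcal V$ and with $x^2:=x\circ x$, $$x\circ y=y\circ x,\qquad x\circ(x^2\circ y)=x^2\circ(x\circ y),\qquad \langle x\circ y,z\rangle=\langle x,y\circ z\rangle,$$ and with a unit element $e\in\mathcal V$, that is, $x\circ e=x$ for all $x$. Its symmetric cone is $\mathcal V_+=\{x\circ x: x\in\mathcal V\}$. Write $x\ge 0$ if $x\in\mathcal V_+$, $x>0$ if $x$ lies in the interior of $\mathcal V_+$, and $x<0$ if $-x>0$. A linear map $L:\mathcal V\to\mathcal V$ has the $\mathbf Q$-property relative to $\mathcal V_+$, written $L\in\mathbf Q(\mathcal V)$, if for every $q\in\mathcal V$ there is $x\in\mathcal V$ with $x\ge 0$, $L(x)+q\ge 0$ and $\langle x,L(x)+q\rangle=0$. **Theorem.** Let $\mathcal V$ be a Euclidean Jordan algebra, let $a,b\in\mathcal V$, and let $L=a\otimes b$ be the linear map $L(x)=\langle b,x\rangle\,a$. Then the following statements are equivalent: (i) $a>0$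 and $b>0$, or $a<0$ and $b<0$; (ii) for every $x\in\mathcal V$, if $0\ne x\ge 0$ then $L(x)>0$; (iii) $L\in\mathbf Q(\mathcal V)$. -/

import Mathlib

/-- A Euclidean Jordan algebra: a finite-dimensional real inner product space with a bilinear
product that is commutative, satisfies the Jordan identity, is compatible with the inner product,
and has a unit element. The inner product is any compatible one; the trace inner product
`⟨x, y⟩ = trace (x ∘ y)` is a particular case. -/
class EuclideanJordanAlgebra (V : Type*) [NormedAddCommGroup V] [InnerProductSpace ℝ V]
    [FiniteDimensional ℝ V] where
  /-- The Jordan product `x ∘ y`, as a bilinear map. -/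
  jmul : V →ₗ[ℝ] V →ₗ[ℝ] V
  /-- The unit element `e`. -/
  unit : V
  jmul_comm : ∀ x y : V, jmul x y = jmul y x
  jordan_identity : ∀ x y : V, jmul x (jmul (jmul x x) y) = jmul (jmul x x) (jmul x y)
  inner_jmul : ∀ x y z : V, inner ℝ (jmul x y) z = inner ℝ x (jmul y z)
  jmul_unit : ∀ x : V, jmul x unit = x

namespace EuclideanJordanAlgebra

/-- The symmetric cone `V₊ = {x ∘ x : x ∈ V}`. -/
def symmetricCone (V : Type*) [NormedAddCommGroup V] [InnerProductSpace ℝ V]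
    [FiniteDimensional ℝ V] [EuclideanJordanAlgebra V] : Set V :=
  {z : V | ∃ x : V, z = jmul x x}

/-- `x ≥ 0`: membership in the symmetric cone. -/
def IsNonneg {V : Type*} [NormedAddCommGroup V] [InnerProductSpace ℝ V]
    [FiniteDimensional ℝ V] [EuclideanJordanAlgebra V] (x : V) : Prop :=
  x ∈ symmetricCone V

/-- `x > 0`: membership in the interior of the symmetric cone. -/
def IsPos {V : Type*} [NormedAddCommGroup V] [InnerProductSpace ℝ V]
    [FiniteDimensional ℝ V] [EuclideanJordanAlgebra V] (x : V) : Prop :=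
  x ∈ interior (symmetricCone V)

/-- `x < 0`, that is, `-x > 0`. -/
def IsNeg {V : Type*} [NormedAddCommGroup V] [InnerProductSpace ℝ V]
    [FiniteDimensional ℝ V] [EuclideanJordanAlgebra V] (x : V) : Prop :=
  IsPos (-x)

/-- `x` solves the symmetric cone linear complementarity problem `LCP(L, V₊, q)`:
`x ≥ 0`, `L x + q ≥ 0` and `⟨x, L x + q⟩ = 0`. -/
def IsLCPSolution {V : Type*} [NormedAddCommGroup V] [InnerProductSpace ℝ V]
    [FiniteDimensional ℝ V] [EuclideanJordanAlgebra V] (L : V →ₗ[ℝ] V) (q x : V) : Prop :=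
  IsNonneg x ∧ IsNonneg (L x + q) ∧ inner ℝ x (L x + q) = 0

/-- `L` has the Q-property relative to `V₊`: `LCP(L, V₊, q)` is solvable for every `q`. -/
def HasQProperty {V : Type*} [NormedAddCommGroup V] [InnerProductSpace ℝ V]
    [FiniteDimensional ℝ V] [EuclideanJordanAlgebra V] (L : V →ₗ[ℝ] V) : Prop :=
  ∀ q : V, ∃ x : V, IsLCPSolution L q x

/-- The transformation `a ⊗ b`, given by `x ↦ ⟨b, x⟩ a`. -/
noncomputable def tensor {V : Type*} [NormedAddCommGroup V] [InnerProductSpace ℝ V]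
    (a b : V) : V →ₗ[ℝ] V :=
  (InnerProductSpace.rankOne ℝ a b).toLinearMap

theorem tensor_apply {V : Type*} [NormedAddCommGroup V] [InnerProductSpace ℝ V]
    (a b x : V) : tensor a b x = (inner ℝ b x : ℝ) • a := by
  simp [tensor]

end EuclideanJordanAlgebra

namespace EuclideanJordanAlgebra

open Polynomial

/-! Apart from self-duality of the cone, the argument is convex geometry. If `a, b > 0`, take the
least `t ≥ 0` with `t • a + q ≥ 0`. Either `t = 0` and `0` is a solution, or `t • a + q` is a
boundary point, orthogonal to some nonzero `y ≥ 0`, and a multiple of `y` solves the problem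
(`hasQProperty_tensor`). Conversely, `q = -e` forces `a` or `-a` to be interior, and
`tensor_neg_neg` reduces to `a > 0`. A Moreau decomposition of `b` then gives a `q` that is
unsolvable unless `b > 0` (`isPos_right_of_hasQProperty`). Self-duality (`isNonneg_iff`) rests on
the spectral decomposition into idempotents, together with positive semidefiniteness of
multiplication by an idempotent. -/

theorem tensor_neg_neg {V : Type*} [NormedAddCommGroup V] [InnerProductSpace ℝ V] (a b : V) :
    tensor (-a) (-b) = tensor a b := by
  ext x
  simp [tensor_apply]

/-! ### Power associativity. -/

section Algebra

variable {V : Type*} [NormedAddCommGroup V] [InnerProductSpace ℝ V]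
  [FiniteDimensional ℝ V] [EuclideanJordanAlgebra V]

/-- The linearized Jordan identity. -/
theorem linearized_jordan_identity (x z y : V) :
    jmul z (jmul (jmul x x) y) + (2 : ℝ) • jmul x (jmul (jmul x z) y) =
      jmul (jmul x x) (jmul z y) + (2 : ℝ) • jmul (jmul x z) (jmul x y) := by
  have h1 := jordan_identity (x + z) y
  have h2 := jordan_identity (x - z) y
  have h3 := jordan_identity z y
  simp only [map_add, map_sub, LinearMap.add_apply, LinearMap.sub_apply, jmul_comm z x] at h1 h2
  -- The difference of `h1` and `h2` keeps the terms odd in `z`; `h3` removes the cubic one.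
  linear_combination (norm := module) (1 / 2 : ℝ) • h1 - (1 / 2 : ℝ) • h2 - h3

/-- The linearized identity read as an operator in `z`. It drives the induction on powers and, at `x
= y = c`, gives the cubic equation of an idempotent. -/
theorem jmul_sq_jmul (x y : V) :
    (jmul (jmul (jmul x x) y) : Module.End ℝ V) =
      jmul (jmul x x) * jmul y + (2 : ℝ) • (jmul (jmul x y) * jmul x) -
        (2 : ℝ) • (jmul x * jmul y * jmul x) := by
  ext z
  have h := linearized_jordan_identity x z y
  simp only [LinearMap.sub_apply, LinearMap.add_apply, LinearMap.smul_apply, Module.End.mul_apply]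
  rw [jmul_comm (jmul (jmul x x) y) z, jmul_comm y z, jmul_comm (jmul x y) (jmul x z),
    jmul_comm y (jmul x z)]
  linear_combination (norm := module) h

theorem jmul_isSymmetric (x : V) : (jmul x : V →ₗ[ℝ] V).IsSymmetric := by
  intro y z
  rw [jmul_comm x y, inner_jmul]

theorem commute_jmul_sq (x : V) :
    Commute (jmul (jmul x x) : Module.End ℝ V) (jmul x : Module.End ℝ V) := by
  ext y
  exact (jordan_identity x y).symm

theorem jmul_unit_eq_one : (jmul (unit : V) : Module.End ℝ V) = 1 := by
  ext y
  rw [jmul_comm, jmul_unit]; rfl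

/-- The value at `x` of a real polynomial. -/
noncomputable def polyEval (x : V) (p : ℝ[X]) : V :=
  (aeval (jmul x : Module.End ℝ V) p) unit

theorem polyEval_X (x : V) : polyEval x X = x := by
  simp [polyEval, jmul_unit]

theorem polyEval_one (x : V) : polyEval x 1 = unit := by
  simp [polyEval]

theorem polyEval_add (x : V) (p q : ℝ[X]) : polyEval x (p + q) = polyEval x p + polyEval x q := by
  simp [polyEval]

theorem polyEval_sum {ι : Type*} (x : V) (s : Finset ι) (p : ι → ℝ[X]) :
    polyEval x (∑ i ∈ s, p i) = ∑ i ∈ s, polyEval x (p i) := by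
  simp [polyEval]

theorem polyEval_C_mul (x : V) (r : ℝ) (p : ℝ[X]) : polyEval x (C r * p) = r • polyEval x p := by
  simp [polyEval, Algebra.algebraMap_eq_smul_one]

theorem polyEval_X_pow_succ (x : V) (n : ℕ) :
    polyEval x (X ^ (n + 1)) = jmul x (polyEval x (X ^ n)) := by
  simp [polyEval, pow_succ']

theorem polyEval_X_pow_add_two (x : V) (n : ℕ) :
    polyEval x (X ^ (n + 2)) = jmul (jmul x x) (polyEval x (X ^ n)) := by
  induction n with
  | zero => simp [polyEval, pow_succ', jmul_unit]
  | succ n ih =>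
    rw [polyEval_X_pow_succ, ih, polyEval_X_pow_succ, jordan_identity]

theorem commute_jmul_polyEval_X_pow (x : V) (n : ℕ) :
    Commute (jmul (polyEval x (X ^ n)) : Module.End ℝ V) (jmul x : Module.End ℝ V) := by
  induction n using Nat.twoStepInduction with
  | zero => rw [pow_zero, polyEval_one, jmul_unit_eq_one]; exact Commute.one_left _
  | one => rw [pow_one, polyEval_X]
  | more n h0 h1 =>
    rw [polyEval_X_pow_add_two, jmul_sq_jmul, ← polyEval_X_pow_succ]
    have hx := Commute.refl (jmul x : Module.End ℝ V)
    exact (((commute_jmul_sq x).mul_left h0).add_left ((h1.mul_left hx).smul_left _)).sub_left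
      (((hx.mul_left h0).mul_left hx).smul_left _)

theorem commute_jmul_polyEval (x : V) (p : ℝ[X]) :
    Commute (jmul (polyEval x p) : Module.End ℝ V) (jmul x : Module.End ℝ V) := by
  induction p using Polynomial.induction_on' with
  | add p q hp hq => rw [polyEval_add, map_add]; exact hp.add_left hq
  | monomial n r =>
    rw [← C_mul_X_pow_eq_monomial, polyEval_C_mul, map_smul]
    exact (commute_jmul_polyEval_X_pow x n).smul_left r

/-- Power associativity: evaluation at `x` is multiplicative. -/
theorem jmul_polyEval (x : V) (p q : ℝ[X]) :
    jmul (polyEval x p) (polyEval x q) = polyEval x (p * q) := by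
  have h : Commute (jmul (polyEval x p) : Module.End ℝ V)
      (aeval (jmul x : Module.End ℝ V) q) := by
    induction q using Polynomial.induction_on' with
    | add f g hf hg => rw [map_add]; exact hf.add_right hg
    | monomial n r =>
      rw [aeval_monomial]
      exact (Algebra.commute_algebraMap_right r _).mul_right ((commute_jmul_polyEval x p).pow_right n)
  have h' := LinearMap.congr_fun h.eq (unit : V)
  simp only [Module.End.mul_apply] at h'
  rw [polyEval.eq_1 x q, h', jmul_unit, mul_comm, polyEval, polyEval, map_mul, Module.End.mul_apply]

/-! ### Spectral decomposition. -/

/-- A finite set containing all eigenvalues of multiplication by `x`. -/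
noncomputable def spectralValues (x : V) : Finset ℝ :=
  Finset.univ.image ((jmul_isSymmetric x).eigenvalues rfl)

/-- Multiplication by `x` is symmetric, hence diagonalizable, so a polynomial in it depends only on
the values at the eigenvalues. -/
theorem polyEval_congr (x : V) {p q : ℝ[X]} (h : ∀ s ∈ spectralValues x, p.eval s = q.eval s) :
    polyEval x p = polyEval x q := by
  have : aeval (jmul x : Module.End ℝ V) p = aeval (jmul x : Module.End ℝ V) q := by
    refine ((jmul_isSymmetric x).eigenvectorBasis rfl).toBasis.ext fun i => ?_
    have hi := (jmul_isSymmetric x).hasEigenvector_eigenvectorBasis rfl i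
    rw [OrthonormalBasis.coe_toBasis, Module.End.aeval_apply_of_hasEigenvector hi,
      Module.End.aeval_apply_of_hasEigenvector hi]
    exact congrArg (· • _) (h _ (Finset.mem_image_of_mem _ (Finset.mem_univ i)))
  rw [polyEval, this, polyEval]

/-- The spectral idempotent of `x` at `s`. -/
noncomputable def spectralIdempotent (x : V) (s : ℝ) : V :=
  polyEval x (Lagrange.basis (spectralValues x) id s)

theorem polyEval_eq_sum (x : V) (p : ℝ[X]) :
    polyEval x p = ∑ s ∈ spectralValues x, p.eval s • spectralIdempotent x s := by
  have h : polyEval x p =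
      polyEval x (Lagrange.interpolate (spectralValues x) id fun s => p.eval s) :=
    polyEval_congr x fun s hs =>
      (Lagrange.eval_interpolate_at_node (fun s => p.eval s) Function.injective_id.injOn hs).symm
  rw [h, Lagrange.interpolate_apply, polyEval_sum]
  simp only [polyEval_C_mul, spectralIdempotent]

theorem jmul_polyEval_spectralIdempotent (x : V) (p : ℝ[X]) (s : ℝ) :
    jmul (polyEval x p) (spectralIdempotent x s) = p.eval s • spectralIdempotent x s := by
  rw [spectralIdempotent, jmul_polyEval, ← polyEval_C_mul]
  refine polyEval_congr x fun t ht => ?_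
  rcases eq_or_ne s t with rfl | hst
  · simp
  · have h0 : (Lagrange.basis (spectralValues x) id s).eval t = 0 :=
      Lagrange.eval_basis_of_ne (v := id) hst ht
    simp [h0]

theorem spectralIdempotent_isIdempotent (x : V) {s : ℝ} (hs : s ∈ spectralValues x) :
    jmul (spectralIdempotent x s) (spectralIdempotent x s) = spectralIdempotent x s := by
  have h1 : (Lagrange.basis (spectralValues x) id s).eval s = 1 :=
    Lagrange.eval_basis_self (v := id) Function.injective_id.injOn hs
  have h := jmul_polyEval_spectralIdempotent x (Lagrange.basis (spectralValues x) id s) s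
  rwa [h1, one_smul] at h

/-! ### Self-duality. -/

/-- Multiplication by `c` is a root of `2T³ - 3T² + T`, so its eigenvalues lie in `{0, 1/2, 1}`.
There `T = T² + 4T²(1 - T)²`, a sum of squares. -/
theorem inner_jmul_idempotent_nonneg {c : V} (hc : jmul c c = c) (y : V) :
    0 ≤ inner ℝ (jmul c y) y := by
  have hP := LinearMap.congr_fun (jmul_sq_jmul c c)
  simp only [hc, LinearMap.sub_apply, LinearMap.add_apply, LinearMap.smul_apply,
    Module.End.mul_apply] at hP
  have h3 : (2 : ℝ) • jmul c (jmul c (jmul c y)) = (3 : ℝ) • jmul c (jmul c y) - jmul c y := by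
    linear_combination (norm := module) hP y
  set u := jmul c y
  have h4 : (2 : ℝ) • jmul c (jmul c (jmul c u)) = (3 : ℝ) • jmul c (jmul c u) - jmul c u := by
    simpa using congrArg (jmul c) h3
  have hu : u = jmul c u + (4 : ℝ) • (jmul c (u - jmul c u) - jmul c (jmul c (u - jmul c u))) := by
    simp only [map_sub]
    linear_combination (norm := module) h3 - (2 : ℝ) • h4
  have hi : inner ℝ u y = ‖u‖ ^ 2 + 4 * ‖u - jmul c u‖ ^ 2 := by
    have hsym := jmul_isSymmetric c
    have e1 : inner ℝ (jmul c u) y = inner ℝ u u := hsym u y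
    have e2 : inner ℝ (jmul c (u - jmul c u)) y = inner ℝ (u - jmul c u) u := hsym _ y
    have e3 : inner ℝ (jmul c (jmul c (u - jmul c u))) y =
        inner ℝ (u - jmul c u) (jmul c u) := by
      rw [← hsym]
      exact hsym _ y
    conv_lhs => rw [hu]
    rw [inner_add_left, real_inner_smul_left, inner_sub_left, e1, e2, e3, ← inner_sub_right,
      real_inner_self_eq_norm_sq, real_inner_self_eq_norm_sq]
  rw [hi]
  positivity

theorem inner_nonneg {x y : V} (hx : IsNonneg x) (hy : IsNonneg y) : 0 ≤ inner ℝ x y := by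
  obtain ⟨u, rfl⟩ := hx
  obtain ⟨v, rfl⟩ := hy
  have hu : jmul u u = polyEval u (X * X) := by rw [← jmul_polyEval, polyEval_X]
  rw [← inner_jmul, hu, polyEval_eq_sum, map_sum, LinearMap.sum_apply, sum_inner]
  refine Finset.sum_nonneg fun s hs => ?_
  rw [map_smul, LinearMap.smul_apply, real_inner_smul_left, eval_mul, eval_X]
  exact mul_nonneg (mul_self_nonneg s)
    (inner_jmul_idempotent_nonneg (spectralIdempotent_isIdempotent u hs) v)

/-- Pairing `x` with each spectral idempotent shows that its coefficient is nonnegative, so an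
interpolated square root squares to `x`. -/
theorem isNonneg_of_forall_inner_nonneg {x : V} (h : ∀ y : V, IsNonneg y → 0 ≤ inner ℝ x y) :
    IsNonneg x := by
  set r : ℝ[X] := Lagrange.interpolate (spectralValues x) id Real.sqrt
  have hr : ∀ s ∈ spectralValues x, r.eval s = √s := fun s hs =>
    Lagrange.eval_interpolate_at_node Real.sqrt Function.injective_id.injOn hs
  refine ⟨polyEval x r, ?_⟩
  rw [jmul_polyEval, polyEval_eq_sum x (r * r)]
  conv_lhs => rw [← polyEval_X x, polyEval_eq_sum x X]
  refine Finset.sum_congr rfl fun s hs => ?_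
  rw [eval_X, eval_mul, hr s hs]
  -- Multiplication by `x` can have eigenvalues, possibly negative, that do not occur in the
  -- decomposition of `x`; their idempotents vanish.
  rcases eq_or_ne (spectralIdempotent x s) 0 with h0 | h0
  · simp [h0]
  have hxs := jmul_polyEval_spectralIdempotent x X s
  have hid := spectralIdempotent_isIdempotent x hs
  rw [polyEval_X, eval_X] at hxs
  have h1 := h _ ⟨spectralIdempotent x s, rfl⟩
  rw [← inner_jmul, hxs, real_inner_smul_left, real_inner_self_eq_norm_sq] at h1
  have hn : 0 < ‖spectralIdempotent x s‖ ^ 2 := by positivity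
  rw [Real.mul_self_sqrt (nonneg_of_mul_nonneg_left h1 hn)]

end Algebra

/-! ### Geometry of the cone. -/

section Cone

variable {V : Type*} [NormedAddCommGroup V] [InnerProductSpace ℝ V]
  [FiniteDimensional ℝ V] [EuclideanJordanAlgebra V]

/-- The symmetric cone is self-dual. -/
theorem isNonneg_iff {x : V} : IsNonneg x ↔ ∀ y : V, IsNonneg y → 0 ≤ inner ℝ x y :=
  ⟨fun hx _ hy => inner_nonneg hx hy, isNonneg_of_forall_inner_nonneg⟩

theorem isNonneg_zero : IsNonneg (0 : V) :=
  isNonneg_iff.2 fun y _ => by simp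

theorem IsNonneg.add {x y : V} (hx : IsNonneg x) (hy : IsNonneg y) : IsNonneg (x + y) :=
  isNonneg_iff.2 fun z hz => by
    rw [inner_add_left]
    exact add_nonneg (inner_nonneg hx hz) (inner_nonneg hy hz)

theorem IsNonneg.smul {x : V} (hx : IsNonneg x) {r : ℝ} (hr : 0 ≤ r) : IsNonneg (r • x) :=
  isNonneg_iff.2 fun z hz => by
    rw [real_inner_smul_left]
    exact mul_nonneg hr (inner_nonneg hx hz)

variable (V) in
theorem convex_symmetricCone : Convex ℝ (symmetricCone V) :=
  fun _ hx _ hy _ _ hr hs _ => IsNonneg.add (IsNonneg.smul hx hr) (IsNonneg.smul hy hs)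

variable (V) in
theorem isClosed_symmetricCone : IsClosed (symmetricCone V) := by
  have h : symmetricCone V = ⋂ y ∈ symmetricCone V, {x : V | 0 ≤ inner ℝ x y} := by
    ext x
    simp only [Set.mem_iInter]
    exact isNonneg_iff
  rw [h]
  exact isClosed_biInter fun y _ => isClosed_le continuous_const (by fun_prop)

theorem IsPos.isNonneg {x : V} (hx : IsPos x) : IsNonneg x :=
  interior_subset (s := symmetricCone V) hx

theorem IsPos.exists_sub_smul {x : V} (hx : IsPos x) (y : V) :
    ∃ ε : ℝ, 0 < ε ∧ IsPos (x - ε • y) := by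
  have hc : ContinuousAt (fun r : ℝ => x - r • y) 0 := by fun_prop
  have hmem : interior (symmetricCone V) ∈ nhds (x - (0 : ℝ) • y) :=
    isOpen_interior.mem_nhds (by rwa [zero_smul, sub_zero])
  obtain ⟨δ, hδ, h⟩ := Metric.eventually_nhds_iff.1 (hc.eventually hmem)
  refine ⟨δ / 2, by positivity, h ?_⟩
  rw [Real.dist_eq, sub_zero, abs_of_pos (by positivity)]
  linarith

theorem IsPos.inner_pos {x y : V} (hx : IsPos x) (hy : IsNonneg y) (hy0 : y ≠ 0) :
    0 < inner ℝ x y := by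
  obtain ⟨ε, hε, h⟩ := hx.exists_sub_smul y
  have h1 := inner_nonneg h.isNonneg hy
  rw [inner_sub_left, real_inner_smul_left, real_inner_self_eq_norm_sq] at h1
  have : 0 < ε * ‖y‖ ^ 2 := by positivity
  linarith

/-- By compactness the pairing with unit vectors of the cone is at least some `m > 0`, and the ball
of radius `m` about `x` stays in the cone. -/
theorem isPos_of_forall_inner_pos {x : V}
    (h : ∀ y : V, IsNonneg y → y ≠ 0 → 0 < inner ℝ x y) : IsPos x := by
  have hcomp : IsCompact (symmetricCone V ∩ Metric.sphere 0 1) :=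
    (isCompact_sphere 0 1).inter_left (isClosed_symmetricCone V)
  obtain ⟨m, hm, hmin⟩ : ∃ m : ℝ, 0 < m ∧
      ∀ y ∈ symmetricCone V ∩ Metric.sphere 0 1, m ≤ inner ℝ x y := by
    rcases (symmetricCone V ∩ Metric.sphere 0 1).eq_empty_or_nonempty with he | hne
    · exact ⟨1, one_pos, by simp [he]⟩
    · obtain ⟨y, hy, hmin⟩ := hcomp.exists_isMinOn hne
        (f := fun y => inner ℝ x y) (by fun_prop)
      exact ⟨_, h y hy.1 (ne_zero_of_mem_unit_sphere ⟨y, hy.2⟩), fun z hz => hmin hz⟩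
  refine mem_interior.2 ⟨Metric.ball x m, fun w hw => ?_, Metric.isOpen_ball,
    Metric.mem_ball_self hm⟩
  refine isNonneg_of_forall_inner_nonneg fun y hy => ?_
  rcases eq_or_ne y 0 with rfl | hy0
  · simp
  have hn : 0 < ‖y‖ := norm_pos_iff.2 hy0
  have h1 := hmin (‖y‖⁻¹ • y) ⟨hy.smul (by positivity), by simp [norm_smul, hn.ne']⟩
  rw [real_inner_smul_right, ← div_eq_inv_mul, le_div_iff₀ hn] at h1
  have h2 : inner ℝ (x - w) y ≤ ‖x - w‖ * ‖y‖ := real_inner_le_norm _ _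
  rw [inner_sub_left] at h2
  have h3 : ‖x - w‖ < m := by rwa [← dist_eq_norm, dist_comm]
  nlinarith

theorem isPos_iff {x : V} : IsPos x ↔ ∀ y : V, IsNonneg y → y ≠ 0 → 0 < inner ℝ x y :=
  ⟨fun hx _ => hx.inner_pos, isPos_of_forall_inner_pos⟩

theorem IsPos.smul {x : V} (hx : IsPos x) {r : ℝ} (hr : 0 < r) : IsPos (r • x) :=
  isPos_iff.2 fun y hy hy0 => by
    rw [real_inner_smul_left]
    exact mul_pos hr (hx.inner_pos hy hy0)

theorem IsPos.add_isNonneg {x y : V} (hx : IsPos x) (hy : IsNonneg y) : IsPos (x + y) :=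
  isPos_iff.2 fun z hz hz0 => by
    rw [inner_add_left]
    exact add_pos_of_pos_of_nonneg (hx.inner_pos hz hz0) (inner_nonneg hy hz)

theorem IsNonneg.exists_inner_eq_zero {x : V} (hx : IsNonneg x) (h : ¬ IsPos x) :
    ∃ y : V, IsNonneg y ∧ y ≠ 0 ∧ inner ℝ x y = 0 := by
  rw [isPos_iff] at h
  push Not at h
  obtain ⟨y, hy, hy0, hxy⟩ := h
  exact ⟨y, hy, hy0, le_antisymm hxy (inner_nonneg hx hy)⟩

theorem isNonneg_unit : IsNonneg (unit : V) :=
  ⟨unit, (jmul_unit _).symm⟩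

theorem isPos_unit : IsPos (unit : V) := by
  refine isPos_of_forall_inner_pos fun y hy hy0 => ?_
  obtain ⟨u, rfl⟩ := hy
  have hu : u ≠ 0 := by
    rintro rfl
    simp at hy0
  rw [← inner_jmul, jmul_comm, jmul_unit, real_inner_self_eq_norm_sq]
  positivity

theorem unit_ne_zero [Nontrivial V] : (unit : V) ≠ 0 := by
  intro h
  obtain ⟨x, hx⟩ := exists_ne (0 : V)
  exact hx (by rw [← jmul_unit x, h, map_zero])

/-- The Moreau decomposition with respect to the symmetric cone. -/
theorem exists_moreau_decomposition (b : V) :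
    ∃ p n : V, IsNonneg p ∧ IsNonneg n ∧ inner ℝ p n = 0 ∧ b = p - n := by
  obtain ⟨p, hp, hmin⟩ := exists_norm_eq_iInf_of_complete_convex ⟨0, isNonneg_zero (V := V)⟩
    (isClosed_symmetricCone V).isComplete (convex_symmetricCone V) b
  rw [norm_eq_iInf_iff_real_inner_le_zero (convex_symmetricCone V) hp] at hmin
  -- Testing at `0` and `2p` bounds `⟨b - p, p⟩` from both sides.
  have h0 := hmin 0 isNonneg_zero
  have h2 := hmin ((2 : ℝ) • p) (IsNonneg.smul hp zero_le_two)
  rw [zero_sub, inner_neg_right] at h0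
  rw [two_smul, add_sub_cancel_right] at h2
  have horth : inner ℝ (b - p) p = 0 := by linarith
  refine ⟨p, p - b, hp, isNonneg_of_forall_inner_nonneg fun y hy => ?_, ?_, by abel⟩
  · have := hmin y hy
    rw [inner_sub_right, horth] at this
    rw [← neg_sub, inner_neg_left]
    linarith
  · rw [real_inner_comm, ← neg_sub, inner_neg_left, horth, neg_zero]

/-! ### The implications between the three statements. -/

theorem isPos_tensor_apply {a b x : V} (ha : IsPos a) (hb : IsPos b) (hx0 : x ≠ 0)
    (hx : IsNonneg x) : IsPos (tensor a b x) := by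
  rw [tensor_apply]
  exact ha.smul (hb.inner_pos hx hx0)

theorem isPos_right_of_forall_isPos_tensor [Nontrivial V] {a b : V} (ha : IsPos a)
    (h : ∀ x : V, x ≠ 0 → IsNonneg x → IsPos (tensor a b x)) : IsPos b := by
  refine isPos_of_forall_inner_pos fun y hy hy0 => ?_
  have h1 := (h y hy0 hy).inner_pos isNonneg_unit unit_ne_zero
  rw [tensor_apply, real_inner_smul_left] at h1
  exact pos_of_mul_pos_left h1 (ha.inner_pos isNonneg_unit unit_ne_zero).le

theorem isPos_or_isNeg_of_isPos_smul [Nontrivial V] {a : V} {r : ℝ} (h : IsPos (r • a)) :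
    IsPos a ∨ IsNeg a := by
  rcases lt_trichotomy r 0 with hr | rfl | hr
  · right
    have := h.smul (inv_pos.2 (neg_pos.2 hr))
    rwa [smul_smul, inv_neg, neg_mul, inv_mul_cancel₀ hr.ne, neg_one_smul] at this
  · have := h.inner_pos isNonneg_unit unit_ne_zero
    simp at this
  · left
    have := h.smul (inv_pos.2 hr)
    rwa [smul_smul, inv_mul_cancel₀ hr.ne', one_smul] at this

theorem IsPos.exists_isNonneg_smul_add {a : V} (ha : IsPos a) (q : V) :
    ∃ t : ℝ, 0 ≤ t ∧ IsNonneg (t • a + q) := by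
  obtain ⟨ε, hε, h⟩ := ha.exists_sub_smul (-q)
  refine ⟨ε⁻¹, by positivity, ?_⟩
  have := h.isNonneg.smul (inv_nonneg.2 hε.le)
  rwa [smul_sub, smul_smul, inv_mul_cancel₀ hε.ne', one_smul, sub_neg_eq_add] at this

theorem hasQProperty_tensor {a b : V} (ha : IsPos a) (hb : IsPos b) :
    HasQProperty (tensor a b) := by
  intro q
  set T : Set ℝ := {t | 0 ≤ t ∧ IsNonneg (t • a + q)}
  have hT : IsClosed T :=
    (isClosed_le continuous_const continuous_id).inter
      ((isClosed_symmetricCone V).preimage (f := fun t : ℝ => t • a + q) (by fun_prop))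
  have hbdd : BddBelow T := ⟨0, fun t ht => ht.1⟩
  obtain ⟨ht0, htq⟩ : sInf T ∈ T := hT.csInf_mem (ha.exists_isNonneg_smul_add q) hbdd
  set t := sInf T
  rcases ht0.eq_or_lt with ht | ht
  · refine ⟨0, isNonneg_zero, ?_, inner_zero_left _⟩
    rw [map_zero]
    rwa [← ht, zero_smul] at htq
  have hnot : ¬ IsPos (t • a + q) := by
    intro hpos
    obtain ⟨ε, hε, h⟩ := hpos.exists_sub_smul a
    have hmem : t - min ε t ∈ T := by
      refine ⟨sub_nonneg.2 (min_le_right _ _), ?_⟩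
      have := h.isNonneg.add (ha.isNonneg.smul (sub_nonneg.2 (min_le_left ε t)))
      convert this using 1
      module
    have := csInf_le hbdd hmem
    have : 0 < min ε t := lt_min hε ht
    linarith
  obtain ⟨y, hy, hy0, hqy⟩ := htq.exists_inner_eq_zero hnot
  have hby := hb.inner_pos hy hy0
  have hval : tensor a b ((t / inner ℝ b y) • y) = t • a := by
    rw [tensor_apply, real_inner_smul_right, div_mul_cancel₀ _ hby.ne']
  refine ⟨(t / inner ℝ b y) • y, hy.smul (by positivity), ?_, ?_⟩
  · rwa [hval]
  · rw [hval, real_inner_smul_left, real_inner_comm (t • a + q) y, hqy, mul_zero]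

theorem isPos_or_isNeg_of_hasQProperty [Nontrivial V] {a b : V}
    (h : HasQProperty (tensor a b)) : IsPos a ∨ IsNeg a := by
  -- A multiple of `a` dominates the unit, hence is interior.
  obtain ⟨x, -, hx, -⟩ := h (-unit)
  have := isPos_unit.add_isNonneg hx
  rw [add_comm, neg_add_cancel_right, tensor_apply] at this
  exact isPos_or_isNeg_of_isPos_smul this

theorem isPos_right_of_hasQProperty {a b : V} (ha : IsPos a)
    (h : HasQProperty (tensor a b)) : IsPos b := by
  obtain ⟨p, n, hp, hn, hpn, rfl⟩ := exists_moreau_decomposition b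
  by_cases hpos : IsPos p
  · have hn0 : n = 0 := by
      by_contra hn0
      exact (hpos.inner_pos hn hn0).ne' hpn
    rwa [hn0, sub_zero]
  exfalso
  obtain ⟨y, hy, hy0, hpy⟩ := hp.exists_inner_eq_zero hpos
  -- With `τ = ⟨b, x⟩`, pairing with `y` gives `τ ≥ 1`. Complementarity, `(τ - 1)⟨a, x⟩ + ⟨p, x⟩ =
  -- 0`, then forces `⟨p, x⟩ = 0`, so `τ = -⟨n, x⟩ ≤ 0`.
  obtain ⟨x, hx, hxq, hcomp⟩ := h (p - a)
  rw [tensor_apply] at hxq hcomp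
  have h1 := inner_nonneg hxq hy
  simp only [inner_add_left, inner_sub_left, inner_add_right, inner_sub_right,
    real_inner_smul_left, real_inner_smul_right, hpy] at h1 hcomp
  have hay := ha.inner_pos hy hy0
  have hax := inner_nonneg ha.isNonneg hx
  have hpx := inner_nonneg hp hx
  have hnx := inner_nonneg hn hx
  rw [real_inner_comm a x, real_inner_comm p x] at hcomp
  have ht : 1 ≤ inner ℝ p x - inner ℝ n x := by
    by_contra hlt
    nlinarith
  nlinarith

end Cone

end EuclideanJordanAlgebra

theorem mainTheorem4 {V : Type*} [NormedAddCommGroup V] [InnerProductSpace ℝ V]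
    [FiniteDimensional ℝ V] [EuclideanJordanAlgebra V] (a b : V) :
    List.TFAE
      [(EuclideanJordanAlgebra.IsPos a ∧ EuclideanJordanAlgebra.IsPos b) ∨
          (EuclideanJordanAlgebra.IsNeg a ∧ EuclideanJordanAlgebra.IsNeg b),
        ∀ x : V, x ≠ 0 → EuclideanJordanAlgebra.IsNonneg x →
          EuclideanJordanAlgebra.IsPos (EuclideanJordanAlgebra.tensor a b x),
        EuclideanJordanAlgebra.HasQProperty (EuclideanJordanAlgebra.tensor a b)] := by
  open EuclideanJordanAlgebra in
  rcases subsingleton_or_nontrivial V with hV | hV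
  · have hpos : ∀ x : V, IsPos x := fun x =>
      isPos_of_forall_inner_pos fun y _ hy => absurd (Subsingleton.elim y 0) hy
    have hQ : HasQProperty (tensor a b) := hasQProperty_tensor (hpos a) (hpos b)
    have h1 : (IsPos a ∧ IsPos b) ∨ (IsNeg a ∧ IsNeg b) := Or.inl ⟨hpos a, hpos b⟩
    tfae_have 1 ↔ 2 := iff_of_true h1 fun x _ _ => hpos _
    tfae_have 1 ↔ 3 := iff_of_true h1 hQ
    tfae_finish
  tfae_have 1 → 2 := by
    rintro (⟨ha, hb⟩ | ⟨ha, hb⟩) x hx0 hx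
    · exact isPos_tensor_apply ha hb hx0 hx
    · rw [← tensor_neg_neg]
      exact isPos_tensor_apply ha hb hx0 hx
  tfae_have 1 → 3 := by
    rintro (⟨ha, hb⟩ | ⟨ha, hb⟩)
    · exact hasQProperty_tensor ha hb
    · rw [← tensor_neg_neg]
      exact hasQProperty_tensor ha hb
  tfae_have 2 → 1 := by
    intro h
    have he := h unit unit_ne_zero isNonneg_unit
    rw [tensor_apply] at he
    refine (isPos_or_isNeg_of_isPos_smul he).imp
      (fun ha => ⟨ha, isPos_right_of_forall_isPos_tensor ha h⟩) fun ha => ⟨ha, ?_⟩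
    rw [← tensor_neg_neg] at h
    exact isPos_right_of_forall_isPos_tensor ha h
  tfae_have 3 → 1 := by
    intro h
    refine (isPos_or_isNeg_of_hasQProperty h).imp
      (fun ha => ⟨ha, isPos_right_of_hasQProperty ha h⟩) fun ha => ⟨ha, ?_⟩
    rw [← tensor_neg_neg] at h
    exact isPos_right_of_hasQProperty ha h
  tfae_finish
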